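/- Let $d\ge 2$, and let $F$ and $F_0$ be probability distributions on $\mathbb{R}^d$, each having a density that is positive and bounded on every bounded subset of $\mathbb{R}^d$. Let $\mathbf x_1,\mathbf x_2,\dots$ be i.i.d. random vectors with distribution $F$, and write $\mathbf x_k=(x_{k,1},\dots,x_{k,d})$. For each $n$, let $$\mathbf u_k=\mathbf u_{k}^{(n)}=\frac1n\sum_{1\le j\le n,\ \mathbf x_j\ne\mathbf x_k}\frac{\mathbf x_k-\mathbf x_j}{\|\mathbf x_k-\mathbf x_j\|},\qquad k=1,\dots,n,$$ be the spatial ranks of the data points. For $\|\mathbf u\|<1$ let $Q_{F_0}(\mathbf u)=(Q_{F_0,1}(\mathbf u),\dots,Q_{F_0,d}(\mathbf u))$ be the spatial quantile of $F_0$, $$Q_{F_0}(\mathbf u)=\arg\min_{Q\in\mathbb{R}^d}\int\bigl\{\Phi(\mathbf u,\mathbf x-Q)-\Phi(\mathbf u,\mathbf x)\bigr\}\,dF_0(\mathbf x),\qquad \Phi(\mathbf u,\mathbf s)=\|\mathbf s\|+\langle\mathbf u,\mathbf s\rangle .$$ For $0<r<1$ and $i=1,\dots,d$ let $$S_{n,i}^{r}=\bigl\{(x_{k,i},\,Q_{F_0,i}(\mathbf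 u_k)) : 1\le k\le n,\ \|\mathbf u_k\|\le r\bigr\}\subset\mathbb{R}^2$$ be the $i$-th one-sample Q–Q plot constructed from the ranks lying in the closed ball of radius $r$ centred at the origin, and let $L(\varepsilon)\subset\mathbb{R}^2$ be the (open, Euclidean) $\varepsilon$-neighbourhood of the line $\{(x,y):y=x\}$. Then $$\lim_{n\to\infty}P\Bigl(\bigcap_{i=1}^{d}\bigl[S_{n,i}^{r}\subseteq L(\varepsilon)\bigr]\Bigr)=1\quad\text{for every } r\in(0,1)\text{ and every }\varepsilon>0$$ if and only if $F=F_0$. -/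

import Mathlib

open MeasureTheory ProbabilityTheory Filter Topology

namespace SpatialQQ

/-- `F` has a density with respect to Lebesgue measure on `ℝ^d` that is positive everywhere and
bounded on every bounded subset of `ℝ^d`. -/
def HasPosLocBddDensity {d : ℕ} (F : Measure (EuclideanSpace ℝ (Fin d))) : Prop :=
  ∃ f : EuclideanSpace ℝ (Fin d) → ℝ,
    Measurable f ∧ (∀ x, 0 < f x) ∧
    (∀ s : Set (EuclideanSpace ℝ (Fin d)), Bornology.IsBounded s → ∃ C : ℝ, ∀ x ∈ s, f x ≤ C) ∧
    F = volume.withDensity (fun x => ENNReal.ofReal (f x))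

open scoped Classical in
/-- The spatial rank of `z` with respect to the data cloud `x_1, …, x_n`:
`n⁻¹ ∑_{i : x_i ≠ z} (z - x_i) / ‖z - x_i‖`. -/
noncomputable def spatialRank {d n : ℕ} (x : Fin n → EuclideanSpace ℝ (Fin d))
    (z : EuclideanSpace ℝ (Fin d)) : EuclideanSpace ℝ (Fin d) :=
  (n : ℝ)⁻¹ • ∑ i ∈ Finset.univ.filter (fun i => x i ≠ z), ‖z - x i‖⁻¹ • (z - x i)

/-- `Φ(u, s) = ‖s‖ + ⟨u, s⟩`. -/
noncomputable def Phi {d : ℕ} (u s : EuclideanSpace ℝ (Fin d)) : ℝ :=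
  ‖s‖ + inner ℝ u s

/-- `q` minimizes `Q ↦ E {Φ(u, x - Q) - Φ(u, x)}` over `ℝ^d`, where `x` has law `F`.
The integrand is bounded in `x`, hence integrable for every probability measure `F`. -/
def IsSpatialQuantile {d : ℕ} (F : Measure (EuclideanSpace ℝ (Fin d)))
    (u q : EuclideanSpace ℝ (Fin d)) : Prop :=
  IsMinOn (fun Q => ∫ x, (Phi u (x - Q) - Phi u x) ∂F) Set.univ q

/-- The spatial quantile `Q_F(u)`, the argmin of `Q ↦ E {Φ(u, x - Q) - Φ(u, x)}`. (For `‖u‖ < 1`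
and `F` not supported on a line the minimizer exists and is unique.) -/
noncomputable def spatialQuantile {d : ℕ} (F : Measure (EuclideanSpace ℝ (Fin d)))
    (u : EuclideanSpace ℝ (Fin d)) : EuclideanSpace ℝ (Fin d) :=
  Classical.epsilon (fun q => IsSpatialQuantile F u q)

/-- The `i`-th Q–Q plot of the data `x_1, …, x_n` against `F₀`: the points
`(x_{k,i}, Q_{F₀,i}(u_k))`, where `u_k` is the spatial rank of `x_k` in the data, constructed from
those `u_k` that lie in the closed ball of radius `r` around the origin. -/
noncomputable def qqPlot {d n : ℕ} (x : Fin n → EuclideanSpace ℝ (Fin d))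
    (F₀ : Measure (EuclideanSpace ℝ (Fin d))) (r : ℝ) (i : Fin d) :
    Set (EuclideanSpace ℝ (Fin 2)) :=
  {p | ∃ k : Fin n, spatialRank x (x k) ∈ Metric.closedBall 0 r ∧
    p = !₂[x k i, spatialQuantile F₀ (spatialRank x (x k)) i]}

/-- `L(ε)`: the `ε`-neighbourhood in the Euclidean plane of the line with slope `1` and
intercept `0`. -/
def lineNhd (ε : ℝ) : Set (EuclideanSpace ℝ (Fin 2)) :=
  Metric.thickening ε {p | p 1 = p 0}

end SpatialQQ

namespace SpatialQQ

/-! The rank map `rankMap F z = E[(z - x) / ‖z - x‖]` is the gradient of the convex potential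
`normPotential F`, and `Q_{F₀}(u)` solves `rankMap F₀ Q = u` (`rankMap_spatialQuantile`). By
Hoeffding's inequality, conditionally on each data point, and a union bound, the sample ranks are
uniformly close to `rankMap F (x_k)` (`tendsto_measure_exists_le_norm_spatialRank_sub`).

If `F = F₀`, then `x_k` and `Q_F(u_k)` have nearby images under `rankMap F`. That map is injective
with bounded sublevel sets `‖rankMap F z‖ ≤ r < 1`, so its inverse is uniformly continuous there
(`exists_rankMap_dist_lt`) and the two points are close.

Conversely, if the rank maps differ at some `z`, a data point near `z` whose rank is accurate leaves
the strip, and a data point falls near `z` with positive probability. So the rank maps agree, hence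
so do the potentials, their antiderivatives. Second differences of the potential are, up to a
constant, Fourier transforms of the characteristic function times an explicit weight, so inversion
recovers `F` (`eq_of_normPotential_eq`). -/

lemma abs_norm_sub_sub_norm_le {V : Type*} [SeminormedAddCommGroup V] (x z : V) :
    |‖x - z‖ - ‖x‖| ≤ ‖z‖ := by
  simpa using abs_norm_sub_norm_le (x - z) x

/-! ### The rank map and its potential: monotonicity, growth, injectivity. -/

section Rank

variable {V : Type*} [NormedAddCommGroup V] [InnerProductSpace ℝ V]

/-- The direction `v / ‖v‖` of `v`, with value `0` at `v = 0`. -/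
noncomputable def dir (v : V) : V := ‖v‖⁻¹ • v

lemma norm_dir_le (v : V) : ‖dir v‖ ≤ 1 := by
  rw [dir, norm_smul, norm_inv, norm_norm]
  exact inv_mul_le_one

lemma norm_smul_dir (v : V) : ‖v‖ • dir v = v := by
  by_cases h : v = 0
  · simp [h]
  · rw [dir, smul_smul, mul_inv_cancel₀ (norm_ne_zero_iff.2 h), one_smul]

lemma inner_dir_self (v : V) : inner ℝ (dir v) v = ‖v‖ := by
  by_cases h : v = 0
  · simp [h]
  · rw [dir, real_inner_smul_left, real_inner_self_eq_norm_sq]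
    have := norm_ne_zero_iff.2 h
    field_simp

lemma continuousAt_dir {v : V} (hv : v ≠ 0) : ContinuousAt dir v :=
  (continuous_norm.continuousAt.inv₀ (norm_ne_zero_iff.2 hv)).smul continuousAt_id

lemma hasFDerivAt_norm_of_ne_zero {v : V} (hv : v ≠ 0) :
    HasFDerivAt (fun w : V => ‖w‖) (innerSL ℝ (dir v)) v := by
  have h0 := norm_ne_zero_iff.2 hv
  have h := (hasStrictFDerivAt_norm_sq v).hasFDerivAt.sqrt (pow_ne_zero 2 h0)
  simp only [Real.sqrt_sq (norm_nonneg _)] at h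
  convert h using 1
  ext w
  simp only [dir, innerSL_apply_apply, real_inner_smul_left, _root_.smul_apply,
    smul_eq_mul, nsmul_eq_mul, Nat.cast_ofNat]
  field_simp

/-- The norm is convex, with subgradient `dir`. -/
lemma norm_sub_inner_dir_le (w z : V) : ‖w‖ - inner ℝ (dir w) z ≤ ‖w - z‖ := by
  have h1 : inner ℝ (dir w) (w - z) ≤ ‖w - z‖ :=
    (real_inner_le_norm _ _).trans (mul_le_of_le_one_left (norm_nonneg _) (norm_dir_le _))
  rwa [inner_sub_right, inner_dir_self] at h1

lemma inner_dir_sub_dir_nonneg (v w : V) : 0 ≤ inner ℝ (dir v - dir w) (v - w) := by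
  have h1 := norm_sub_inner_dir_le v (v - w)
  have h2 := norm_sub_inner_dir_le w (w - v)
  rw [sub_sub_cancel] at h1 h2
  rw [← neg_sub v w, inner_neg_right] at h2
  rw [inner_sub_left]
  linarith

/-- Equality in the monotonicity of `dir` forces the two vectors to be positively collinear. -/
lemma norm_smul_eq_of_inner_dir_sub_dir_eq_zero {v w : V} (hv : v ≠ 0) (hw : w ≠ 0)
    (h : inner ℝ (dir v - dir w) (v - w) = 0) : ‖w‖ • v = ‖v‖ • w := by
  rw [← inner_eq_norm_mul_iff_real]
  have a := norm_pos_iff.2 hv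
  have b := norm_pos_iff.2 hw
  have hvw := real_inner_comm v w
  rw [inner_sub_left, inner_sub_right, inner_sub_right, inner_dir_self, inner_dir_self, dir, dir,
    real_inner_smul_left, real_inner_smul_left, hvw] at h
  field_simp at h
  have h' : (‖v‖ + ‖w‖) * (‖v‖ * ‖w‖ - inner ℝ v w) = 0 := by linear_combination h
  rcases mul_eq_zero.1 h' with h | h
  · linarith
  · linarith

variable [MeasurableSpace V]

/-- The spatial rank function of the distribution `F`. -/
noncomputable def rankMap (F : Measure V) (z : V) : V := ∫ x, dir (z - x) ∂F

/-- The potential of `F` for the kernel `‖x - z‖`, normalized to vanish at `0`. -/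
noncomputable def normPotential (F : Measure V) (z : V) : ℝ := ∫ x, (‖x - z‖ - ‖x‖) ∂F

lemma norm_rankMap_le (F : Measure V) [IsProbabilityMeasure F] (z : V) : ‖rankMap F z‖ ≤ 1 := by
  simpa [rankMap] using norm_integral_le_of_norm_le_const (μ := F)
    (ae_of_all _ fun x => norm_dir_le (z - x))

variable [BorelSpace V] [FiniteDimensional ℝ V]

lemma measurable_dir : Measurable (dir : V → V) :=
  measurable_norm.inv.smul measurable_id

/-- This is where dimension at least two enters: a line is a proper affine subspace. Strictness in
the convexity arguments below fails only when `F` lives on a line. -/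
lemma measure_lineMap_range_eq_zero {F : Measure V} (hV : 2 ≤ Module.finrank ℝ V) (hF : F ≪ volume)
    (a b : V) : F {x | ∃ t : ℝ, x = a + t • b} = 0 := by
  let s : AffineSubspace ℝ V := AffineSubspace.mk' a (ℝ ∙ b)
  have hs : s ≠ ⊤ := by
    intro h
    have h1 := congrArg AffineSubspace.direction h
    rw [AffineSubspace.direction_mk', AffineSubspace.direction_top] at h1
    have h2 := finrank_span_le_card (R := ℝ) ({b} : Set V)
    rw [h1, finrank_top] at h2
    simp only [Set.toFinset_singleton, Finset.card_singleton] at h2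
    omega
  refine measure_mono_null ?_ (hF (Measure.addHaar_affineSubspace volume s hs))
  rintro x ⟨t, rfl⟩
  simp [s, AffineSubspace.mem_mk', Submodule.smul_mem]

variable (F : Measure V) [IsProbabilityMeasure F]

lemma integrable_dir_sub (z : V) : Integrable (fun x => dir (z - x)) F :=
  Integrable.of_bound (measurable_dir.comp (measurable_const.sub measurable_id)).aestronglyMeasurable
    1 (ae_of_all _ fun _ => norm_dir_le _)

lemma integrable_norm_sub_sub_norm (z : V) : Integrable (fun x => ‖x - z‖ - ‖x‖) F :=
  Integrable.of_bound (by fun_prop) ‖z‖ (ae_of_all _ fun x => abs_norm_sub_sub_norm_le x z)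

lemma continuous_rankMap [NullSingletonClass F] : Continuous (rankMap F) := by
  rw [continuous_iff_continuousAt]
  intro z
  refine continuousAt_of_dominated (bound := fun _ => 1)
    (Eventually.of_forall fun w => (integrable_dir_sub F w).1)
    (Eventually.of_forall fun w => ae_of_all _ fun x => norm_dir_le _) (integrable_const _) ?_
  filter_upwards [F.ae_ne z] with x hx
  exact ContinuousAt.comp (f := fun w => w - x) (continuousAt_dir (sub_ne_zero.2 hx.symm))
    (continuous_id.sub continuous_const).continuousAt

lemma hasFDerivAt_normPotential [NullSingletonClass F] (z : V) :
    HasFDerivAt (normPotential F) (innerSL ℝ (rankMap F z)) z := by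
  have key := hasFDerivAt_integral_of_dominated_loc_of_lip (𝕜 := ℝ) (μ := F) (x₀ := z)
    (F := fun w x => ‖x - w‖ - ‖x‖) (F' := fun x => innerSL ℝ (dir (z - x))) (bound := fun _ => 1)
    univ_mem (Eventually.of_forall fun w => (integrable_norm_sub_sub_norm F w).1)
    (integrable_norm_sub_sub_norm F z)
    ((innerSL ℝ).continuous.comp_aestronglyMeasurable (integrable_dir_sub F z).1)
    (ae_of_all _ fun x => ?_) (integrable_const _) ?_
  · have hcomm := (ContinuousLinearMap.integral_comp_comm
      (innerSL ℝ : V →L[ℝ] V →L[ℝ] ℝ) (integrable_dir_sub F z))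
    have h2 := key.2
    rw [hcomm] at h2
    exact h2
  · refine LipschitzOnWith.of_dist_le_mul fun a _ b _ => ?_
    simp only [map_one, NNReal.coe_one, one_mul, dist_eq_norm]
    have := abs_norm_sub_norm_le (x - a) (x - b)
    rw [sub_sub_sub_cancel_left, norm_sub_rev b a] at this
    rwa [sub_sub_sub_cancel_right, Real.norm_eq_abs]
  · filter_upwards [F.ae_ne z] with x hx
    have h1 : HasFDerivAt (fun w : V => w - x) (ContinuousLinearMap.id ℝ V) z :=
      (hasFDerivAt_id z).sub_const x
    have h2 := ((hasFDerivAt_norm_of_ne_zero (sub_ne_zero.2 hx.symm)).comp z h1).sub_const ‖x‖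
    simp only [Function.comp_def, norm_sub_rev _ x] at h2
    exact h2

/-- The subgradient inequality at `z`, tested at the origin, where the potential vanishes. -/
lemma normPotential_le_inner_rankMap (z : V) :
    normPotential F z ≤ inner ℝ (rankMap F z) z := by
  rw [real_inner_comm, rankMap, ← integral_inner (integrable_dir_sub F z)]
  refine integral_mono (integrable_norm_sub_sub_norm F z)
    ((integrable_dir_sub F z).const_inner z) fun x => ?_
  have h := norm_sub_inner_dir_le (z - x) z
  rw [sub_sub_cancel_left, norm_neg] at h
  rw [norm_sub_rev, real_inner_comm]
  linarith

/-- The potential of a probability measure grows at least like `c ‖z‖` for every `c < 1`. -/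
lemma exists_normPotential_ge {c : ℝ} (hc : c < 1) :
    ∃ B : ℝ, ∀ z, c * ‖z‖ - B ≤ normPotential F z := by
  have hlim : Tendsto (fun n : ℕ => F.real (Metric.closedBall 0 (n : ℝ))) atTop (𝓝 1) := by
    have h := tendsto_measure_iUnion_atTop (μ := F)
      (s := fun n : ℕ => Metric.closedBall (0 : V) (n : ℝ))
      (fun a b h => Metric.closedBall_subset_closedBall (by exact_mod_cast h))
    rw [Metric.iUnion_closedBall_nat, measure_univ] at h
    simpa [Function.comp_def, Measure.real] using
      (ENNReal.tendsto_toReal ENNReal.one_ne_top).comp h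
  -- The integrand is at least `‖z‖ - 2n` on the ball of radius `n` and at least `-‖z‖` off it; ball
  -- mass `m > (1 + c) / 2` makes the slope `2m - 1` exceed `c`.
  obtain ⟨n, hn⟩ := (hlim.eventually (lt_mem_nhds (show (1 + c) / 2 < 1 by linarith))).exists
  refine ⟨2 * n, fun z => ?_⟩
  set K := Metric.closedBall (0 : V) (n : ℝ)
  have hK : MeasurableSet K := Metric.isClosed_closedBall.measurableSet
  have h1 : ∫ x, (K.indicator (fun _ => 2 * ‖z‖) x - ‖z‖ - 2 * n) ∂F ≤ normPotential F z := by
    refine integral_mono ((((integrable_const _).indicator hK).sub (integrable_const _)).sub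
      (integrable_const _)) (integrable_norm_sub_sub_norm F z) fun x => ?_
    have hn0 : (0 : ℝ) ≤ n := n.cast_nonneg
    by_cases hx : x ∈ K
    · have hx' : ‖x‖ ≤ n := by simpa [K] using hx
      have := norm_sub_norm_le z x
      simp only [Set.indicator_of_mem hx]
      rw [norm_sub_rev x z]
      linarith
    · have := (abs_le.1 (abs_norm_sub_sub_norm_le x z)).1
      simp only [Set.indicator_of_notMem hx]
      linarith
  have hi : Integrable (fun x => K.indicator (fun _ => 2 * ‖z‖) x - ‖z‖) F :=
    ((integrable_const _).indicator hK).sub (integrable_const _)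
  rw [integral_sub hi (integrable_const _), integral_sub ((integrable_const _).indicator hK) (integrable_const _),
    integral_indicator_const _ hK] at h1
  simp only [integral_const, probReal_univ, smul_eq_mul] at h1
  nlinarith [norm_nonneg z]

lemma isBounded_norm_rankMap_le {r : ℝ} (hr : r < 1) :
    Bornology.IsBounded {z | ‖rankMap F z‖ ≤ r} := by
  obtain ⟨c, hrc, hc⟩ := exists_between hr
  obtain ⟨B, hB⟩ := exists_normPotential_ge F hc
  refine isBounded_iff_forall_norm_le.2 ⟨B / (c - r), fun z hz => ?_⟩
  rw [le_div_iff₀ (by linarith)]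
  have h1 := (normPotential_le_inner_rankMap F z).trans (real_inner_le_norm _ _)
  have h2 := mul_le_mul_of_nonneg_right (show ‖rankMap F z‖ ≤ r from hz) (norm_nonneg z)
  linarith [hB z]

variable {F}

/-- Norm one would force `dir (z - x)` to be a.e. constant, placing `F` on a line through `z`. -/
lemma norm_rankMap_lt_one (hV : 2 ≤ Module.finrank ℝ V) (hF : F ≪ volume) (z : V) :
    ‖rankMap F z‖ < 1 := by
  rcases ae_eq_const_or_norm_integral_lt_of_norm_le_const (μ := F)
    (ae_of_all _ fun x => norm_dir_le (z - x)) with h | h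
  · exfalso
    have h0 := measure_lineMap_range_eq_zero hV hF z (⨍ x, dir (z - x) ∂F)
    have h1 : ∀ᵐ x ∂F, False := by
      filter_upwards [h, measure_eq_zero_iff_ae_notMem.1 h0] with x hx hx'
      refine hx' ⟨-‖z - x‖, ?_⟩
      have := norm_smul_dir (z - x)
      simp only [Function.const_apply] at hx
      rw [hx] at this
      rw [neg_smul, this]
      abel
    simp at h1
    exact IsProbabilityMeasure.ne_zero F h1
  · simpa [rankMap] using h

/-- Monotonicity of `dir` makes the integrand nonnegative. If the images coincide it vanishes a.e.,
so almost every `x` is collinear with `a` and `b`, and a line is null. -/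
lemma rankMap_injective (hV : 2 ≤ Module.finrank ℝ V) (hF : F ≪ volume) [NullSingletonClass F] :
    Function.Injective (rankMap F) := by
  intro a b hab
  by_contra hne
  have hint : Integrable (fun x => inner ℝ (a - b) (dir (a - x) - dir (b - x))) F :=
    ((integrable_dir_sub F a).sub (integrable_dir_sub F b)).const_inner _
  have h0 : ∫ x, inner ℝ (a - b) (dir (a - x) - dir (b - x)) ∂F = 0 := by
    have hi : Integrable (fun x => dir (a - x) - dir (b - x)) F :=
      (integrable_dir_sub F a).sub (integrable_dir_sub F b)
    rw [integral_inner hi,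
      integral_sub (integrable_dir_sub F a) (integrable_dir_sub F b)]
    change inner ℝ (a - b) (rankMap F a - rankMap F b) = 0
    simp [hab]
  have hnn : ∀ x, 0 ≤ inner ℝ (a - b) (dir (a - x) - dir (b - x)) := fun x => by
    have := inner_dir_sub_dir_nonneg (a - x) (b - x)
    rwa [sub_sub_sub_cancel_right, real_inner_comm] at this
  rw [integral_eq_zero_iff_of_nonneg hnn hint] at h0
  have h1 : ∀ᵐ x ∂F, False := by
    filter_upwards [h0, F.ae_ne a, F.ae_ne b,
      measure_eq_zero_iff_ae_notMem.1 (measure_lineMap_range_eq_zero hV hF a (a - b))]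
      with x hx hxa hxb hx'
    have hc := norm_smul_eq_of_inner_dir_sub_dir_eq_zero (sub_ne_zero.2 hxa.symm)
      (sub_ne_zero.2 hxb.symm)
      (by rw [sub_sub_sub_cancel_right, real_inner_comm]; exact hx)
    have hn : ‖b - x‖ ≠ ‖a - x‖ := by
      intro hn
      rw [hn] at hc
      have := smul_right_injective V (norm_ne_zero_iff.2 (sub_ne_zero.2 hxa.symm)) hc
      exact hne (sub_left_injective this)
    -- The parameter solves `‖b - x‖ • (a - x) = ‖a - x‖ • (b - x)` for `x - a`.
    refine hx' ⟨‖a - x‖ / (‖b - x‖ - ‖a - x‖), ?_⟩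
    have hn' := sub_ne_zero.2 hn
    have h3 : (‖b - x‖ - ‖a - x‖) • (x - a) = ‖a - x‖ • (a - b) := by
      have : ‖b - x‖ • (a - x) - ‖a - x‖ • (b - x) = 0 := sub_eq_zero.2 hc
      rw [← sub_eq_zero, ← neg_eq_zero, ← this]
      module
    rw [div_eq_inv_mul, mul_smul, ← h3, smul_smul, inv_mul_cancel₀ hn', one_smul]
    abel
  simp at h1
  exact IsProbabilityMeasure.ne_zero F h1

/-- On sublevel sets of the norm of the rank map, its inverse is uniformly continuous. -/
lemma exists_rankMap_dist_lt (hV : 2 ≤ Module.finrank ℝ V) (hF : F ≪ volume) [NullSingletonClass F]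
    {r ε : ℝ} (hr : r < 1) (hε : 0 < ε) :
    ∃ δ > 0, ∀ a b, ‖rankMap F a‖ ≤ r → ‖rankMap F b‖ ≤ r →
      ‖rankMap F a - rankMap F b‖ < δ → ‖a - b‖ < ε := by
  have hcont := continuous_rankMap F
  have hK : IsCompact {z | ‖rankMap F z‖ ≤ r} :=
    Metric.isCompact_of_isClosed_isBounded (isClosed_le hcont.norm continuous_const)
      (isBounded_norm_rankMap_le F hr)
  have hC : IsCompact (({z | ‖rankMap F z‖ ≤ r} ×ˢ {z | ‖rankMap F z‖ ≤ r}) ∩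
      {p : V × V | ε ≤ ‖p.1 - p.2‖}) :=
    (hK.prod hK).inter_right (isClosed_le continuous_const (by fun_prop))
  have hf : Continuous fun p : V × V => ‖rankMap F p.1 - rankMap F p.2‖ :=
    ((hcont.comp continuous_fst).sub (hcont.comp continuous_snd)).norm
  rcases Set.eq_empty_or_nonempty (({z | ‖rankMap F z‖ ≤ r} ×ˢ {z | ‖rankMap F z‖ ≤ r}) ∩
      {p : V × V | ε ≤ ‖p.1 - p.2‖}) with he | he
  · refine ⟨1, one_pos, fun a b ha hb _ => ?_⟩
    by_contra! h
    exact Set.notMem_empty (a, b) (he ▸ ⟨⟨ha, hb⟩, h⟩)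
  -- On the compact set of pairs at distance at least `ε`, the gap between images attains a minimum,
  -- positive by injectivity; it serves as `δ`.
  · obtain ⟨p, ⟨_, hp⟩, hmin⟩ := hC.exists_isMinOn he hf.continuousOn
    refine ⟨‖rankMap F p.1 - rankMap F p.2‖, ?_, fun a b ha hb hab => ?_⟩
    · refine norm_pos_iff.2 (sub_ne_zero.2 fun h => ?_)
      have h0 := rankMap_injective hV hF h
      have hp' : ε ≤ ‖p.1 - p.2‖ := hp
      rw [h0, sub_self, norm_zero] at hp'
      linarith
    · by_contra! h
      exact absurd (hmin (a := (a, b)) ⟨⟨ha, hb⟩, h⟩) (not_le.2 hab)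

lemma normPotential_eq_of_rankMap_eq {F₀ : Measure V} [IsProbabilityMeasure F₀] [NullSingletonClass F]
    [NullSingletonClass F₀] (h : rankMap F = rankMap F₀) : normPotential F = normPotential F₀ := by
  have hd : ∀ z, HasFDerivAt (fun z => normPotential F z - normPotential F₀ z) 0 z := fun z => by
    have := (hasFDerivAt_normPotential F z).sub (hasFDerivAt_normPotential F₀ z)
    rwa [h, sub_self] at this
  ext z
  have := is_const_of_fderiv_eq_zero (fun z => (hd z).differentiableAt) (fun z => (hd z).fderiv) z 0
  simpa [normPotential, sub_eq_zero] using this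

end Rank

/-! ### Spatial quantiles invert the rank map. -/

section Quantile

variable {d : ℕ} (F : Measure (EuclideanSpace ℝ (Fin d))) [IsProbabilityMeasure F]

lemma integral_Phi_sub (u q : EuclideanSpace ℝ (Fin d)) :
    ∫ x, (Phi u (x - q) - Phi u x) ∂F = normPotential F q - inner ℝ u q := by
  have h : ∀ x, Phi u (x - q) - Phi u x = (‖x - q‖ - ‖x‖) - inner ℝ u q := fun x => by
    rw [Phi, Phi, inner_sub_right]; ring
  simp_rw [h]
  rw [integral_sub (integrable_norm_sub_sub_norm F q) (integrable_const _)]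
  simp [normPotential]

lemma exists_isSpatialQuantile [NullSingletonClass F] {u : EuclideanSpace ℝ (Fin d)} (hu : ‖u‖ < 1) :
    ∃ q, IsSpatialQuantile F u q := by
  have hcont : Continuous fun q => normPotential F q - inner ℝ u q := by
    have : Continuous (normPotential F) :=
      continuous_iff_continuousAt.2 fun z => (hasFDerivAt_normPotential F z).continuousAt
    fun_prop
  obtain ⟨c, huc, hc⟩ := exists_between hu
  obtain ⟨B, hB⟩ := exists_normPotential_ge F hc
  have hlim : Tendsto (fun q => normPotential F q - inner ℝ u q) (cocompact _) atTop := by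
    refine tendsto_atTop_mono (f := fun q => (c - ‖u‖) * ‖q‖ + -B) (fun q => ?_)
      (tendsto_atTop_add_const_right _ _
        ((tendsto_norm_cocompact_atTop).const_mul_atTop (by linarith)))
    have := real_inner_le_norm u q
    linarith [hB q]
  obtain ⟨q, hq⟩ := hcont.exists_forall_le hlim
  refine ⟨q, fun y _ => ?_⟩
  simpa only [Set.mem_ofPred_eq, integral_Phi_sub] using hq y

/-- The first-order condition for `normPotential F q - ⟨u, q⟩`. It holds at every minimizer, so the
choice made by `Classical.epsilon` does not matter. -/
lemma rankMap_spatialQuantile [NullSingletonClass F] {u : EuclideanSpace ℝ (Fin d)} (hu : ‖u‖ < 1) :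
    rankMap F (spatialQuantile F u) = u := by
  have h : IsSpatialQuantile F u (spatialQuantile F u) :=
    Classical.epsilon_spec (exists_isSpatialQuantile F hu)
  set q := spatialQuantile F u
  unfold IsSpatialQuantile at h
  simp only [integral_Phi_sub] at h
  have hd : HasFDerivAt (fun q => normPotential F q - inner ℝ u q)
      (innerSL ℝ (rankMap F q) - innerSL ℝ u) q :=
    (hasFDerivAt_normPotential F q).sub (innerSL ℝ u).hasFDerivAt
  have h0 := (h.isLocalMin univ_mem).hasFDerivAt_eq_zero hd
  rw [← map_sub] at h0
  have h1 := DFunLike.congr_fun h0 (rankMap F q - u)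
  rwa [innerSL_apply_apply, _root_.zero_apply, inner_self_eq_zero, sub_eq_zero] at h1

end Quantile

/-! ### The potential determines the measure. -/

section Fourier

variable {V : Type*} [NormedAddCommGroup V] [InnerProductSpace ℝ V]

/-- The weight `(1 - cos ⟨t, x⟩) / ‖t‖ ^ (dim V + 1)`, whose integral is proportional to `‖x‖`. -/
noncomputable def cosWeight (x t : V) : ℝ :=
  (1 - Real.cos (inner ℝ t x)) / ‖t‖ ^ (Module.finrank ℝ V + 1)

lemma cosWeight_nonneg (x t : V) : 0 ≤ cosWeight x t :=
  div_nonneg (by linarith [Real.cos_le_one (inner ℝ t x)]) (by positivity)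

lemma cosWeight_neg (x t : V) : cosWeight x (-t) = cosWeight x t := by
  simp [cosWeight]

lemma continuousAt_cosWeight (x : V) {t : V} (ht : t ≠ 0) : ContinuousAt (cosWeight x) t := by
  unfold cosWeight
  exact ContinuousAt.div (by fun_prop) (by fun_prop) (pow_ne_zero _ (norm_ne_zero_iff.2 ht))

variable [MeasurableSpace V] [BorelSpace V] [FiniteDimensional ℝ V]

lemma measurable_cosWeight (x : V) : Measurable (cosWeight x) := by
  unfold cosWeight
  fun_prop

lemma integrable_min_one_norm_sq_div [Nontrivial V] :
    Integrable (fun t : V => min 1 (‖t‖ ^ 2) / ‖t‖ ^ (Module.finrank ℝ V + 1)) := by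
  have hD : 0 < Module.finrank ℝ V := Module.finrank_pos
  rw [integrable_fun_norm_addHaar volume
    (f := fun y : ℝ => min 1 (y ^ 2) / y ^ (Module.finrank ℝ V + 1))]
  have heq : Set.EqOn (fun y : ℝ => min 1 (y ^ 2) / y ^ 2)
      (fun y : ℝ => y ^ (Module.finrank ℝ V - 1) • (min 1 (y ^ 2) / y ^ (Module.finrank ℝ V + 1)))
      (Set.Ioi 0) := by
    intro y hy
    have hy' : y ≠ 0 := ne_of_gt hy
    obtain ⟨m, hm⟩ : ∃ m, Module.finrank ℝ V = m + 1 := ⟨_, (Nat.succ_pred_eq_of_pos hD).symm⟩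
    simp only [hm, Nat.add_sub_cancel, smul_eq_mul]
    field_simp
    ring
  refine IntegrableOn.congr_fun ?_ heq measurableSet_Ioi
  rw [← Set.Ioc_union_Ioi_eq_Ioi (zero_le_one (α := ℝ))]
  refine IntegrableOn.union ?_ ?_
  · refine IntegrableOn.congr_fun (f := fun _ => (1 : ℝ)) (by simp) ?_ measurableSet_Ioc
    intro y hy
    have h1 : y ^ 2 ≤ 1 := pow_le_one₀ hy.1.le hy.2
    have h2 : y ^ 2 ≠ 0 := pow_ne_zero _ hy.1.ne'
    simp only [min_eq_right h1, div_self h2]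
  · refine IntegrableOn.congr_fun (integrableOn_Ioi_rpow_of_lt (a := -2) (by norm_num) one_pos)
      ?_ measurableSet_Ioi
    intro y hy
    have hy' : (1 : ℝ) < y := hy
    have h1 : 1 ≤ y ^ 2 := one_le_pow₀ hy'.le
    simp only [min_eq_left h1, Real.rpow_neg (zero_le_one.trans hy'.le), Real.rpow_two, one_div]

lemma integrable_cosWeight [Nontrivial V] (x : V) : Integrable (cosWeight x) := by
  refine (integrable_min_one_norm_sq_div.const_mul (2 + ‖x‖ ^ 2)).mono'
    (measurable_cosWeight x).aestronglyMeasurable (ae_of_all _ fun t => ?_)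
  rw [Real.norm_of_nonneg (cosWeight_nonneg x t), cosWeight, ← mul_div_assoc]
  gcongr
  have h1 := Real.one_sub_sq_div_two_le_cos (x := inner ℝ t x)
  have h2 := Real.neg_one_le_cos (inner ℝ t x)
  have h3 : (inner ℝ t x) ^ 2 ≤ (‖t‖ * ‖x‖) ^ 2 := sq_le_sq' (by
    linarith [neg_le_of_abs_le (abs_real_inner_le_norm t x)]) (real_inner_le_norm t x)
  rw [mul_pow] at h3
  rcases min_cases 1 (‖t‖ ^ 2) with ⟨h, _⟩ | ⟨h, _⟩ <;> rw [h] <;>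
    nlinarith [sq_nonneg ‖x‖, sq_nonneg ‖t‖]

/-- Substituting `a • t` trades `a ^ (D + 1)` from the weight against `a ^ (-D)` from volume, where
`D` is the dimension. -/
lemma integral_cosWeight_smul {a : ℝ} (ha : 0 < a) (x : V) :
    ∫ t, cosWeight (a • x) t = a * ∫ t, cosWeight x t := by
  have h : ∀ t : V, cosWeight (a • x) t =
      a ^ (Module.finrank ℝ V + 1) * cosWeight x (a • t) := fun t => by
    simp only [cosWeight, real_inner_smul_left, real_inner_smul_right, norm_smul,
      Real.norm_of_nonneg ha.le, mul_pow]
    field_simp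
  simp_rw [h]
  rw [integral_const_mul, Measure.integral_comp_smul, abs_of_pos (by positivity), smul_eq_mul]
  field_simp
  ring

/-- The reflection exchanging `x` and `y` preserves volume and the weight's denominator. -/
lemma integral_cosWeight_eq_of_norm_eq {x y : V} (h : ‖x‖ = ‖y‖) :
    ∫ t, cosWeight x t = ∫ t, cosWeight y t := by
  let g := (ℝ ∙ (x - y))ᗮ.reflection
  have hg : g x = y := Submodule.reflection_sub h
  rw [← g.measurePreserving.integral_comp g.toHomeomorph.measurableEmbedding (cosWeight y)]
  congr 1 with t
  simp only [cosWeight]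
  rw [← hg, LinearIsometryEquiv.inner_map_map, LinearIsometryEquiv.norm_map]

lemma exists_integral_cosWeight_eq [Nontrivial V] :
    ∃ c : ℝ, ∀ x : V, ∫ t, cosWeight x t = c * ‖x‖ := by
  obtain ⟨e, he⟩ := exists_norm_eq V (zero_le_one (α := ℝ))
  refine ⟨∫ t, cosWeight e t, fun x => ?_⟩
  by_cases hx : x = 0
  · simp [hx, cosWeight]
  · have h0 := norm_pos_iff.2 hx
    rw [mul_comm, ← integral_cosWeight_smul h0 e]
    exact integral_cosWeight_eq_of_norm_eq (by simp [norm_smul, he])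

/-- The Fourier transform of the weight is a second difference of the norm. -/
lemma exists_integral_exp_mul_cosWeight [Nontrivial V] :
    ∃ c : ℝ, ∀ h x : V, ∫ t, Complex.exp ((inner ℝ x t : ℝ) * Complex.I) * (cosWeight h t : ℂ) =
      ((c * (‖x + h‖ + ‖x - h‖ - 2 * ‖x‖) : ℝ) : ℂ) := by
  obtain ⟨c, hc⟩ := exists_integral_cosWeight_eq (V := V)
  refine ⟨c / 2, fun h x => ?_⟩
  have hint : Integrable
      (fun t => Complex.exp ((inner ℝ x t : ℝ) * Complex.I) * (cosWeight h t : ℂ)) := by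
    refine (integrable_cosWeight h).ofReal.bdd_mul (c := 1) (by fun_prop)
      (ae_of_all _ fun t => ?_)
    rw [Complex.norm_exp_ofReal_mul_I]
  -- The identity `cos a (1 - cos b) = ½[(1 - cos (a + b)) + (1 - cos (a - b)) - 2(1 - cos a)]`; the
  -- imaginary part is odd in `t`.
  have hre : ∀ t : V,
      (Complex.exp ((inner ℝ x t : ℝ) * Complex.I) * (cosWeight h t : ℂ)).re =
      2⁻¹ * (cosWeight (x + h) t + cosWeight (x - h) t - 2 * cosWeight x t) := fun t => by
    rw [Complex.re_mul_ofReal, Complex.exp_ofReal_mul_I_re]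
    simp only [cosWeight, inner_add_right, inner_sub_right, Real.cos_add, Real.cos_sub,
      real_inner_comm t x]
    ring
  have him : ∀ t : V,
      (Complex.exp ((inner ℝ x t : ℝ) * Complex.I) * (cosWeight h t : ℂ)).im =
      Real.sin (inner ℝ x t) * cosWeight h t := fun t => by
    rw [Complex.im_mul_ofReal, Complex.exp_ofReal_mul_I_im]
  apply Complex.ext
  · have := (integral_re hint).symm
    simp only [RCLike.re_eq_complex_re, hre] at this
    have hadd : Integrable fun t => cosWeight (x + h) t + cosWeight (x - h) t :=
      (integrable_cosWeight _).add (integrable_cosWeight _)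
    rw [this, Complex.ofReal_re, integral_const_mul,
      integral_sub hadd ((integrable_cosWeight _).const_mul 2),
      integral_add (integrable_cosWeight _) (integrable_cosWeight _), integral_const_mul,
      hc, hc, hc]
    ring
  · have := (integral_im hint).symm
    simp only [RCLike.im_eq_complex_im, him] at this
    rw [this, Complex.ofReal_im]
    have hodd := integral_neg_eq_self (fun t => Real.sin (inner ℝ x t) * cosWeight h t) volume
    simp only [inner_neg_right, Real.sin_neg, cosWeight_neg, neg_mul, integral_neg] at hodd
    linarith

variable (F F₀ : Measure V) [IsProbabilityMeasure F] [IsProbabilityMeasure F₀]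

lemma integral_norm_second_difference (h y : V) :
    ∫ x, (‖x - y + h‖ + ‖x - y - h‖ - 2 * ‖x - y‖) ∂F =
      normPotential F (y - h) + normPotential F (y + h) - 2 * normPotential F y := by
  have hi := integrable_norm_sub_sub_norm F
  have hadd : Integrable (fun x => ‖x - (y - h)‖ - ‖x‖ + (‖x - (y + h)‖ - ‖x‖)) F :=
    (hi _).add (hi _)
  rw [normPotential, normPotential, normPotential, ← integral_const_mul,
    ← integral_add (hi _) (hi _), ← integral_sub hadd ((hi _).const_mul 2)]
  congr 1 with x
  rw [sub_add, sub_sub]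
  ring

/-- Fubini: the formula `hc`, taken at `x - y`, is integrated over `x` with respect to `F`. -/
lemma fourier_charFun_mul_cosWeight {c : ℝ} {h : V}
    (hc : ∀ x : V, ∫ t, Complex.exp ((inner ℝ x t : ℝ) * Complex.I) * (cosWeight h t : ℂ) =
      ((c * (‖x + h‖ + ‖x - h‖ - 2 * ‖x‖) : ℝ) : ℂ)) [Nontrivial V] (y : V) :
    ∫ t, Complex.exp (-(inner ℝ y t : ℝ) * Complex.I) * (charFun F t * cosWeight h t) =
      ((c * (normPotential F (y - h) + normPotential F (y + h) - 2 * normPotential F y) : ℝ) :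
        ℂ) := by
  have hI : Integrable (Function.uncurry fun (x t : V) =>
      Complex.exp ((inner ℝ (x - y) t : ℝ) * Complex.I) * (cosWeight h t : ℂ))
      (F.prod volume) := by
    have hw : Integrable fun t => (cosWeight h t : ℂ) := (integrable_cosWeight h).ofReal
    refine (hw.comp_snd F).bdd_mul (c := 1) ?_
      (ae_of_all _ fun t => ?_)
    · exact Continuous.aestronglyMeasurable (by fun_prop)
    · rw [Complex.norm_exp_ofReal_mul_I]
  have hswap := integral_integral_swap hI
  simp only [hc] at hswap
  rw [integral_complex_ofReal, integral_const_mul, integral_norm_second_difference] at hswap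
  rw [hswap]
  congr 1 with t
  rw [charFun_apply, ← mul_assoc, ← integral_const_mul, ← integral_mul_const]
  congr 1 with x
  rw [← Complex.exp_add, inner_sub_left]
  congr 2
  push_cast
  ring

variable {F F₀}

/-- A probability measure is determined by its potential for the kernel `‖x - z‖`. -/
theorem eq_of_normPotential_eq [Nontrivial V] (heq : normPotential F = normPotential F₀) :
    F = F₀ := by
  -- Nothing is needed about `c`, not even `c ≠ 0`: equal potentials give equal transforms in any
  -- case.
  obtain ⟨c, hc⟩ := exists_integral_exp_mul_cosWeight (V := V)
  refine Measure.ext_of_charFun (funext fun t₀ => ?_)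
  by_cases ht : t₀ = 0
  · simp [ht]
  -- Chosen so that `⟨t₀, h⟩ = π`, making the weight nonzero at `t₀`. Inversion applies there
  -- because the weight is continuous away from `0`.
  let h : V := (Real.pi / ‖t₀‖ ^ 2) • t₀
  have hcf : ∀ (G : Measure V) [IsProbabilityMeasure G], Integrable
      (fun t => charFun G t * (cosWeight h t : ℂ)) := fun G _ => by
    refine (integrable_cosWeight h).ofReal.bdd_mul (c := 1)
      (by fun_prop) (ae_of_all _ fun t => norm_charFun_le_one _)
  let g : V → ℂ := fun t => (charFun F t - charFun F₀ t) * (cosWeight h t : ℂ)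
  have hg : Integrable g := by
    simp only [g, sub_mul]
    exact (hcf F).sub (hcf F₀)
  have hft : FourierTransform.fourier g = 0 := by
    ext w
    have hi : ∀ (G : Measure V) [IsProbabilityMeasure G], Integrable (fun t =>
        Complex.exp (-(inner ℝ ((2 * Real.pi) • w) t : ℝ) * Complex.I) *
          (charFun G t * (cosWeight h t : ℂ))) := fun G _ => by
      refine (hcf G).bdd_mul (c := 1) (by fun_prop) (ae_of_all _ fun t => ?_)
      rw [← Complex.ofReal_neg, Complex.norm_exp_ofReal_mul_I]
    have h1 := fourier_charFun_mul_cosWeight F (hc h) ((2 * Real.pi) • w)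
    have h2 := fourier_charFun_mul_cosWeight F₀ (hc h) ((2 * Real.pi) • w)
    rw [heq, ← h2, ← sub_eq_zero, ← integral_sub (hi F) (hi F₀)] at h1
    rw [Real.fourier_eq', Pi.zero_apply, ← h1]
    congr 1 with t
    rw [← mul_sub, ← sub_mul, smul_eq_mul, real_inner_smul_left, real_inner_comm]
    simp only [g]
    congr 3
    push_cast
    ring
  have hcont : ContinuousAt g t₀ := by
    refine ContinuousAt.mul ?_
      (Complex.continuous_ofReal.continuousAt.comp (continuousAt_cosWeight h ht))
    exact (continuous_charFun.sub continuous_charFun).continuousAt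
  have hzero := hg.fourierInv_fourier_eq (by rw [hft]; exact integrable_zero _ _ _) hcont
  have hg0 : g t₀ = 0 := by
    rw [← hzero, hft, Real.fourierInv_eq']
    simp
  have hn := norm_ne_zero_iff.2 ht
  have hw : cosWeight h t₀ ≠ 0 := by
    have : inner ℝ t₀ h = Real.pi := by
      simp only [h, real_inner_smul_right, real_inner_self_eq_norm_sq]
      field_simp
    rw [cosWeight, this, Real.cos_pi]
    positivity
  rcases mul_eq_zero.1 hg0 with h | h
  · exact sub_eq_zero.1 h
  · exact absurd (Complex.ofReal_eq_zero.1 h) hw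

end Fourier

/-! ### Hoeffding bounds for empirical ranks. -/

section Concentration

variable {V : Type*} [NormedAddCommGroup V] [InnerProductSpace ℝ V] [MeasurableSpace V]
  [BorelSpace V] [FiniteDimensional ℝ V] {F : Measure V} [IsProbabilityMeasure F]
  {Ω : Type*} [MeasurableSpace Ω] {P : Measure Ω} [IsProbabilityMeasure P] {X : ℕ → Ω → V}

/-- Hoeffding's inequality for the empirical spatial rank at a fixed point. -/
lemma measureReal_le_sum_inner_dir_sub_rankMap (hlaw : ∀ j, HasLaw (X j) F P)
    (hindep : iIndepFun X P) {w : V} (hw : ‖w‖ ≤ 1) (z : V) (S : Finset ℕ) {t : ℝ} (ht : 0 ≤ t) :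
    P.real {ω | t ≤ ∑ j ∈ S, inner ℝ w (dir (z - X j ω) - rankMap F z)} ≤
      Real.exp (-t ^ 2 / (2 * S.card)) := by
  let g : V → ℝ := fun x => inner ℝ w (dir (z - x))
  have hg : Measurable g :=
    (measurable_dir.comp (measurable_const.sub measurable_id)).const_inner
  have hmean : ∀ j, ∫ ω, g (X j ω) ∂P = inner ℝ w (rankMap F z) := fun j => by
    rw [rankMap, ← integral_inner (integrable_dir_sub F z), ← (hlaw j).map_eq,
      integral_map (hlaw j).aemeasurable hg.aestronglyMeasurable]
  have hsub : ∀ j ∈ S, HasSubgaussianMGF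
      (fun ω => inner ℝ w (dir (z - X j ω) - rankMap F z)) 1 P := fun j _ => by
    have h := hasSubgaussianMGF_of_mem_Icc (μ := P) (a := -1) (b := 1)
      (hg.comp_aemeasurable (hlaw j).aemeasurable) (ae_of_all _ fun ω => by
        have h := (abs_real_inner_le_norm w (dir (z - X j ω))).trans
          (mul_le_one₀ hw (norm_nonneg _) (norm_dir_le _))
        exact abs_le.1 h)
    have hc : (‖(1 : ℝ) - (-1)‖₊ / 2) ^ 2 = 1 := by
      ext
      norm_num
    rw [hc] at h
    simp only [Function.comp_apply, hmean] at h
    simpa only [inner_sub_right] using h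
  have hind : iIndepFun (fun j ω => inner ℝ w (dir (z - X j ω) - rankMap F z)) P :=
    hindep.comp (fun _ x => inner ℝ w (dir (z - x) - rankMap F z)) fun _ =>
      ((measurable_dir.comp (measurable_const.sub measurable_id)).sub measurable_const).const_inner
  simpa using HasSubgaussianMGF.measure_sum_ge_le_of_iIndepFun hind hsub ht

/-- Hoeffding's inequality for the empirical spatial rank at an independent data point. -/
lemma measure_le_sum_inner_dir_sub_rankMap [NullSingletonClass F]
    (hlaw : ∀ j, HasLaw (X j) F P) (hindep : iIndepFun X P) {w : V} (hw : ‖w‖ ≤ 1) {k : ℕ}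
    {S : Finset ℕ} (hk : k ∉ S) {t : ℝ} (ht : 0 ≤ t) :
    P {ω | t ≤ ∑ j ∈ S, inner ℝ w (dir (X k ω - X j ω) - rankMap F (X k ω))} ≤
      ENNReal.ofReal (Real.exp (-t ^ 2 / (2 * S.card))) := by
  have hX : ∀ j, AEMeasurable (X j) P := fun j => (hlaw j).aemeasurable
  let Y : Ω → S → V := fun ω j => X j ω
  have hY : AEMeasurable Y P := aemeasurable_pi_lambda _ fun j => hX j
  have hXY : IndepFun (X k) Y P := by
    have h := hindep.indepFun_finset₀ {k} S (Finset.disjoint_singleton_left.2 hk) hX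
    exact h.comp (φ := fun f : ({k} : Finset ℕ) → V => f ⟨k, Finset.mem_singleton_self k⟩)
      (measurable_pi_apply _) measurable_id
  let A : Set (V × (S → V)) := {p | t ≤ ∑ j, inner ℝ w (dir (p.1 - p.2 j) - rankMap F p.1)}
  have hA : MeasurableSet A := by
    refine measurableSet_le measurable_const (Finset.measurable_sum _ fun j _ => ?_)
    refine Measurable.const_inner (Measurable.sub (measurable_dir.comp ?_) ?_)
    · exact measurable_fst.sub ((measurable_pi_apply j).comp measurable_snd)
    · exact (continuous_rankMap F).measurable.comp measurable_fst
  have hset : {ω | t ≤ ∑ j ∈ S, inner ℝ w (dir (X k ω - X j ω) - rankMap F (X k ω))} =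
      (fun ω => (X k ω, Y ω)) ⁻¹' A := by
    ext ω
    simp only [A, Y, Set.mem_ofPred_eq, Set.mem_preimage]
    rw [Finset.sum_coe_sort S fun j => inner ℝ w (dir (X k ω - X j ω) - rankMap F (X k ω))]
  rw [hset, ← Measure.map_apply_of_aemeasurable ((hX k).prodMk hY) hA,
    (indepFun_iff_map_prod_eq_prod_map_map (hX k) hY).1 hXY, (hlaw k).map_eq]
  have : IsProbabilityMeasure (P.map Y) := Measure.isProbabilityMeasure_map hY
  -- By independence the joint law is a product; each slice, with `X k` frozen at `z`, obeys the
  -- fixed-point bound.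
  rw [Measure.prod_apply hA]
  calc ∫⁻ z, P.map Y (Prod.mk z ⁻¹' A) ∂F
      ≤ ∫⁻ _, ENNReal.ofReal (Real.exp (-t ^ 2 / (2 * S.card))) ∂F := by
        refine lintegral_mono fun z => ?_
        rw [Measure.map_apply_of_aemeasurable hY (measurable_prodMk_left hA)]
        refine (ENNReal.le_ofReal_iff_toReal_le (measure_ne_top _ _) (Real.exp_pos _).le).2 ?_
        refine le_of_eq_of_le ?_
          (measureReal_le_sum_inner_dir_sub_rankMap hlaw hindep hw z S ht)
        rw [Measure.real]
        congr 2
        ext ω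
        simp only [A, Y, Set.mem_ofPred_eq, Set.mem_preimage]
        rw [Finset.sum_coe_sort S fun j => inner ℝ w (dir (z - X j ω) - rankMap F z)]
    _ = _ := by simp

end Concentration

/-! ### Uniform convergence of sample ranks. -/

section Ranks

variable {d : ℕ}

lemma spatialRank_eq_sum_dir {n : ℕ} (x : Fin n → EuclideanSpace ℝ (Fin d))
    (z : EuclideanSpace ℝ (Fin d)) :
    spatialRank x z = (n : ℝ)⁻¹ • ∑ i, dir (z - x i) := by
  classical
  rw [spatialRank, Finset.sum_filter]
  congr 1
  refine Finset.sum_congr rfl fun i _ => ?_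
  by_cases h : x i = z
  · simp [h, dir]
  · rw [if_pos h, dir]

lemma norm_le_sum_abs (v : EuclideanSpace ℝ (Fin d)) : ‖v‖ ≤ ∑ i, |v i| := by
  rw [EuclideanSpace.norm_eq]
  refine Real.sqrt_le_iff.2 ⟨Finset.sum_nonneg fun i _ => abs_nonneg _, ?_⟩
  simpa using Finset.sum_sq_le_sq_sum_of_nonneg (s := Finset.univ) (f := fun i => |v i|)
    fun i _ => abs_nonneg _

/-- The vectors `± eᵢ` of the standard basis. -/
noncomputable def signedBasis (p : Fin d × Bool) : EuclideanSpace ℝ (Fin d) :=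
  (if p.2 then (1 : ℝ) else -1) • EuclideanSpace.single p.1 1

lemma norm_signedBasis_le (p : Fin d × Bool) : ‖signedBasis p‖ ≤ 1 := by
  rw [signedBasis, norm_smul]
  split_ifs <;> simp

/-- Reduces a vector deviation to `2d` scalar ones: some coordinate carries at least a `1 / d` share
of the norm. -/
lemma exists_le_inner_signedBasis {δ : ℝ} (hδ : 0 < δ) {v : EuclideanSpace ℝ (Fin d)}
    (hv : δ ≤ ‖v‖) : ∃ p, δ / d ≤ inner ℝ (signedBasis p) v := by
  by_contra! h
  have hlt : ∀ i, |v i| < δ / d := fun i => by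
    have h1 := h (i, true)
    have h2 := h (i, false)
    simp only [signedBasis, real_inner_smul_left, EuclideanSpace.inner_single_left] at h1 h2
    rw [abs_lt]
    simp at h1 h2
    constructor <;> linarith
  have hd : d ≠ 0 := by
    rintro rfl
    have : v = 0 := Subsingleton.elim _ _
    simp [this] at hv
    linarith
  have hd' : (0 : ℝ) < d := by exact_mod_cast Nat.pos_of_ne_zero hd
  have : Nonempty (Fin d) := Fin.pos_iff_nonempty.1 (Nat.pos_of_ne_zero hd)
  have h3 := Finset.sum_lt_sum_of_nonempty (s := Finset.univ) Finset.univ_nonempty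
    fun i _ => hlt i
  simp only [Finset.sum_const, Finset.card_univ, Fintype.card_fin, nsmul_eq_mul] at h3
  rw [mul_div_cancel₀ _ hd'.ne'] at h3
  linarith [norm_le_sum_abs v]

variable {F : Measure (EuclideanSpace ℝ (Fin d))} [IsProbabilityMeasure F] {Ω : Type*}
  [MeasurableSpace Ω] {P : Measure Ω} [IsProbabilityMeasure P]
  {X : ℕ → Ω → EuclideanSpace ℝ (Fin d)}

/-- Omitting the `k`-th summand, which vanishes, changes the scaled deviation by at most `1`. -/
lemma le_sum_erase_of_le_inner_spatialRank_sub {x : ℕ → EuclideanSpace ℝ (Fin d)} {n : ℕ}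
    (k : Fin n) {w : EuclideanSpace ℝ (Fin d)} (hw : ‖w‖ ≤ 1) {η : ℝ}
    (h : η ≤ inner ℝ w (spatialRank (fun j : Fin n => x j) (x k) - rankMap F (x k))) :
    n * η - 1 ≤ ∑ j ∈ (Finset.range n).erase k,
      inner ℝ w (dir (x k - x j) - rankMap F (x k)) := by
  have hn : (0 : ℝ) < n := by exact_mod_cast k.pos
  have h1 : inner ℝ w (rankMap F (x k)) ≥ -1 :=
    (abs_le.1 ((abs_real_inner_le_norm _ _).trans
      (mul_le_one₀ hw (norm_nonneg _) (norm_rankMap_le F _)))).1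
  have h2 := Finset.add_sum_erase (Finset.range n)
    (fun j => inner ℝ w (dir (x k - x j) - rankMap F (x k))) (Finset.mem_range.2 k.2)
  have h3 : ∑ j ∈ Finset.range n, inner ℝ w (dir (x k - x j) - rankMap F (x k)) =
      n * inner ℝ w (spatialRank (fun j : Fin n => x j) (x k) - rankMap F (x k)) := by
    rw [spatialRank_eq_sum_dir, Fin.sum_univ_eq_sum_range (fun j => dir (x k - x j)), inner_sub_right,
      real_inner_smul_right, inner_sum]
    simp only [inner_sub_right, Finset.sum_sub_distrib, Finset.sum_const, Finset.card_range,
      nsmul_eq_mul]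
    field_simp
  have h4 : inner ℝ w (dir (x k - x k) - rankMap F (x k)) = -inner ℝ w (rankMap F (x k)) := by
    simp [dir]
  have h5 := mul_le_mul_of_nonneg_left h hn.le
  simp only [h4] at h2
  linarith

lemma measure_le_inner_spatialRank_sub [NullSingletonClass F]
    (hlaw : ∀ j, HasLaw (X j) F P) (hindep : iIndepFun X P) {n : ℕ} (k : Fin n)
    {w : EuclideanSpace ℝ (Fin d)} (hw : ‖w‖ ≤ 1) {η : ℝ} (hη : 0 < η) (hn2 : 2 ≤ n)
    (hn : 2 ≤ n * η) :
    P {ω | η ≤ inner ℝ w (spatialRank (fun j : Fin n => X j ω) (X k ω) - rankMap F (X k ω))} ≤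
      ENNReal.ofReal (Real.exp (-(η ^ 2 / 8)) ^ n) := by
  have hn0 : (2 : ℝ) ≤ n := by exact_mod_cast hn2
  -- Since `n * η ≥ 2`, the loss of `1` leaves at least `n * η / 2`; with `n - 1` summands the
  -- Hoeffding exponent is at least `n * η ^ 2 / 8`.
  refine (measure_mono (t := {ω | n * η / 2 ≤ ∑ j ∈ (Finset.range n).erase k,
      inner ℝ w (dir (X k ω - X j ω) - rankMap F (X k ω))}) fun ω hω => ?_).trans
    ((measure_le_sum_inner_dir_sub_rankMap hlaw hindep hw (Finset.notMem_erase _ _)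
      (by positivity)).trans (ENNReal.ofReal_le_ofReal ?_))
  · have := le_sum_erase_of_le_inner_spatialRank_sub (x := fun j => X j ω) k hw hω
    simp only [Set.mem_ofPred_eq]
    linarith
  · rw [Finset.card_erase_of_mem (Finset.mem_range.2 k.2), Finset.card_range, ← Real.exp_nat_mul,
      Nat.cast_sub (by omega), Nat.cast_one, Real.exp_le_exp, div_le_iff₀ (by linarith)]
    have : 0 ≤ η ^ 2 * n := by positivity
    nlinarith

/-- The ranks of the data points are uniformly close to their population values. -/
theorem tendsto_measure_exists_le_norm_spatialRank_sub [NullSingletonClass F]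
    (hlaw : ∀ j, HasLaw (X j) F P) (hindep : iIndepFun X P) {δ : ℝ} (hδ : 0 < δ) :
    Tendsto (fun n : ℕ => P {ω | ∃ k : Fin n,
      δ ≤ ‖spatialRank (fun j : Fin n => X j ω) (X k ω) - rankMap F (X k ω)‖}) atTop (𝓝 0) := by
  rcases Nat.eq_zero_or_pos d with rfl | hd
  · have h0 : ∀ v : EuclideanSpace ℝ (Fin 0), ¬ δ ≤ ‖v‖ := fun v => by
      rw [Subsingleton.elim v 0, norm_zero]
      exact not_le.2 hδ
    simp [h0]
  have hη : 0 < δ / d := div_pos hδ (by exact_mod_cast hd)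
  -- The factor `2dn` counts the pairs of a data point and a signed direction in the union bound.
  have hlim : Tendsto (fun n : ℕ => ENNReal.ofReal
      ((d * 2 : ℕ) * (n * Real.exp (-((δ / d) ^ 2 / 8)) ^ n))) atTop (𝓝 0) := by
    have h := (tendsto_self_mul_const_pow_of_lt_one (Real.exp_pos (-((δ / d) ^ 2 / 8))).le
      (Real.exp_lt_one_iff.2 (neg_lt_zero.2 (by positivity)))).const_mul ((d * 2 : ℕ) : ℝ)
    rw [mul_zero] at h
    simpa using ENNReal.tendsto_ofReal h
  have hbig : ∀ᶠ n : ℕ in atTop, 2 ≤ (n : ℝ) * (δ / d) :=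
    (tendsto_natCast_atTop_atTop.atTop_mul_const hη).eventually_ge_atTop 2
  refine tendsto_of_tendsto_of_tendsto_of_le_of_le' tendsto_const_nhds hlim
    (Eventually.of_forall fun _ => zero_le) ?_
  filter_upwards [hbig, eventually_ge_atTop 2] with n hn hn2
  calc P {ω | ∃ k : Fin n,
        δ ≤ ‖spatialRank (fun j : Fin n => X j ω) (X k ω) - rankMap F (X k ω)‖}
      ≤ P (⋃ p : Fin n × (Fin d × Bool), {ω | δ / d ≤ inner ℝ (signedBasis p.2)
          (spatialRank (fun j : Fin n => X j ω) (X p.1 ω) - rankMap F (X p.1 ω))}) := by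
        refine measure_mono ?_
        rintro ω ⟨k, hk⟩
        obtain ⟨p, hp⟩ := exists_le_inner_signedBasis hδ hk
        exact Set.mem_iUnion.2 ⟨(k, p), hp⟩
    _ ≤ ∑ p : Fin n × (Fin d × Bool), P {ω | δ / d ≤ inner ℝ (signedBasis p.2)
          (spatialRank (fun j : Fin n => X j ω) (X p.1 ω) - rankMap F (X p.1 ω))} :=
        measure_iUnion_fintype_le _ _
    _ ≤ ∑ _p : Fin n × (Fin d × Bool), ENNReal.ofReal (Real.exp (-((δ / d) ^ 2 / 8)) ^ n) :=
        Finset.sum_le_sum fun p _ => measure_le_inner_spatialRank_sub hlaw hindep p.1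
          (norm_signedBasis_le _) hη hn2 hn
    _ = _ := by
        rw [Finset.sum_const, Finset.card_univ, Fintype.card_prod, Fintype.card_prod,
          Fintype.card_fin, Fintype.card_fin, Fintype.card_bool, nsmul_eq_mul,
          ← ENNReal.ofReal_natCast, ← ENNReal.ofReal_mul (Nat.cast_nonneg _)]
        congr 1
        push_cast
        ring

end Ranks

/-! ### The two implications. -/

section Main

variable {d : ℕ}

lemma HasPosLocBddDensity.absolutelyContinuous {F : Measure (EuclideanSpace ℝ (Fin d))}
    (hF : HasPosLocBddDensity F) : F ≪ volume := by
  obtain ⟨f, -, -, -, rfl⟩ := hF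
  exact withDensity_absolutelyContinuous _ _

lemma HasPosLocBddDensity.absolutelyContinuous_volume {F : Measure (EuclideanSpace ℝ (Fin d))}
    (hF : HasPosLocBddDensity F) : volume ≪ F := by
  obtain ⟨f, hf, hpos, -, rfl⟩ := hF
  exact withDensity_absolutelyContinuous' hf.ennreal_ofReal.aemeasurable
    (ae_of_all _ fun x => by simpa using hpos x)

lemma HasPosLocBddDensity.nullSingletonClass (hd : 0 < d)
    {F : Measure (EuclideanSpace ℝ (Fin d))} (hF : HasPosLocBddDensity F) :
    NullSingletonClass F := by
  have : Nonempty (Fin d) := Fin.pos_iff_nonempty.1 hd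
  exact ⟨fun x => hF.absolutelyContinuous (measure_singleton x)⟩

lemma mem_lineNhd_of_abs_sub_lt {a b ε : ℝ} (h : |a - b| < ε) : !₂[a, b] ∈ lineNhd ε := by
  refine Metric.mem_thickening_iff.2 ⟨!₂[a, a], by simp, ?_⟩
  rw [EuclideanSpace.dist_eq]
  simpa [Fin.sum_univ_two, Real.sqrt_sq_eq_abs, Real.dist_eq, abs_sub_comm b a] using h

lemma abs_sub_lt_of_mem_lineNhd {a b ε : ℝ} (h : !₂[a, b] ∈ lineNhd ε) : |a - b| < 2 * ε := by
  obtain ⟨q, hq, hlt⟩ := Metric.mem_thickening_iff.1 h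
  have hq' : q 1 = q 0 := hq
  rw [dist_eq_norm] at hlt
  have h0 := (PiLp.norm_apply_le (!₂[a, b] - q) 0).trans_lt hlt
  have h1 := (PiLp.norm_apply_le (!₂[a, b] - q) 1).trans_lt hlt
  simp only [PiLp.sub_apply, Real.norm_eq_abs, abs_lt] at h0 h1
  simp at h0 h1
  rw [abs_lt]
  constructor <;> linarith

lemma forall_qqPlot_subset_iff {n : ℕ} {x : Fin n → EuclideanSpace ℝ (Fin d)}
    {F₀ : Measure (EuclideanSpace ℝ (Fin d))} {r ε : ℝ} :
    (∀ i, qqPlot x F₀ r i ⊆ lineNhd ε) ↔ ∀ k, ‖spatialRank x (x k)‖ ≤ r →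
      ∀ i, !₂[x k i, spatialQuantile F₀ (spatialRank x (x k)) i] ∈ lineNhd ε := by
  constructor
  · intro h k hk i
    exact h i ⟨k, mem_closedBall_zero_iff.2 hk, rfl⟩
  · rintro h i _ ⟨k, hk, rfl⟩
    exact h k (mem_closedBall_zero_iff.1 hk) i

variable {F F₀ : Measure (EuclideanSpace ℝ (Fin d))} [IsProbabilityMeasure F]
  [IsProbabilityMeasure F₀] {Ω : Type*} [MeasurableSpace Ω] {P : Measure Ω}
  [IsProbabilityMeasure P] {X : ℕ → Ω → EuclideanSpace ℝ (Fin d)}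

theorem tendsto_measure_qqPlot_subset (hd : 2 ≤ d) (hF : F ≪ volume) [NullSingletonClass F]
    (hlaw : ∀ j, HasLaw (X j) F P) (hindep : iIndepFun X P) {r ε : ℝ} (hr1 : r < 1)
    (hε : 0 < ε) :
    Tendsto (fun n : ℕ => P {ω | ∀ i : Fin d,
      qqPlot (fun k : Fin n => X k ω) F r i ⊆ lineNhd ε}) atTop (𝓝 1) := by
  have hV : 2 ≤ Module.finrank ℝ (EuclideanSpace ℝ (Fin d)) := by simpa using hd
  -- A sample rank of norm at most `r` may have a population rank slightly outside that ball, hence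
  -- the margin `r' - r`.
  obtain ⟨r', hrr, hr'⟩ := exists_between hr1
  obtain ⟨δ, hδ, hinv⟩ := exists_rankMap_dist_lt hV hF hr' hε
  have hdev := tendsto_measure_exists_le_norm_spatialRank_sub hlaw hindep
    (lt_min hδ (sub_pos.2 hrr))
  have hlow := ENNReal.Tendsto.sub (tendsto_const_nhds (x := (1 : ENNReal))) hdev
    (Or.inl ENNReal.one_ne_top)
  rw [tsub_zero] at hlow
  refine tendsto_of_tendsto_of_tendsto_of_le_of_le hlow tendsto_const_nhds (fun n => ?_)
    fun n => prob_le_one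
  rw [tsub_le_iff_right, ← measure_univ (μ := P)]
  refine (measure_mono fun ω _ => ?_).trans (measure_union_le _ _)
  by_cases hω : ∃ k : Fin n, min δ (r' - r) ≤
      ‖spatialRank (fun j : Fin n => X j ω) (X k ω) - rankMap F (X k ω)‖
  · exact Or.inr hω
  refine Or.inl (forall_qqPlot_subset_iff.2 fun k hk i => mem_lineNhd_of_abs_sub_lt ?_)
  push Not at hω
  obtain ⟨h1, h2⟩ := lt_min_iff.1 (hω k)
  set u := spatialRank (fun j : Fin n => X j ω) (X k ω)
  have hQ : rankMap F (spatialQuantile F u) = u :=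
    rankMap_spatialQuantile F (hk.trans_lt hr1)
  have h3 : ‖rankMap F (X k ω)‖ ≤ r' := by
    have := norm_le_insert u (rankMap F (X k ω))
    linarith
  have h4 := hinv (X k ω) (spatialQuantile F u) h3 (by rw [hQ]; exact hk.trans hrr.le)
    (by rw [hQ, norm_sub_rev]; exact h1)
  exact (PiLp.norm_apply_le (X k ω - spatialQuantile F u) i).trans_lt h4

/-- Only the first data point is needed. If the rank maps differ at `z`, a good plot forces either
an inaccurate rank or `X 0` outside a ball around `z`; the limiting probability is then at most the
mass of the ball's complement, which is below one. -/
theorem rankMap_eq_of_tendsto_measure_qqPlot_subset (hd : 2 ≤ d) (hF : F ≪ volume)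
    (hF' : volume ≪ F) [NullSingletonClass F] [NullSingletonClass F₀]
    (hlaw : ∀ j, HasLaw (X j) F P) (hindep : iIndepFun X P)
    (h : ∀ r : ℝ, 0 < r → r < 1 → ∀ ε : ℝ, 0 < ε →
      Tendsto (fun n : ℕ => P {ω | ∀ i : Fin d,
        qqPlot (fun k : Fin n => X k ω) F₀ r i ⊆ lineNhd ε}) atTop (𝓝 1)) :
    rankMap F = rankMap F₀ := by
  have hV : 2 ≤ Module.finrank ℝ (EuclideanSpace ℝ (Fin d)) := by simpa using hd
  have hd0 : (0 : ℝ) < d := by exact_mod_cast (by omega : 0 < d)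
  ext1 z
  by_contra hne
  have hgap : 0 < ‖rankMap F z - rankMap F₀ z‖ := norm_pos_iff.2 (sub_ne_zero.2 hne)
  obtain ⟨r, hzr, hr1⟩ := exists_between (norm_rankMap_lt_one hV hF z)
  have hr0 : 0 < r := (norm_nonneg _).trans_lt hzr
  -- Near `z`, `u` is within `2η` of `rankMap F z` (sampling plus continuity), hence in the
  -- `r`-ball; a further `η` leads to `rankMap F₀ z`, contradicting a gap of at least `3η`.
  obtain ⟨η, hη, hηr, hηgap⟩ : ∃ η : ℝ, 0 < η ∧ 2 * η ≤ r - ‖rankMap F z‖ ∧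
      3 * η ≤ ‖rankMap F z - rankMap F₀ z‖ := by
    refine ⟨min (r - ‖rankMap F z‖) ‖rankMap F z - rankMap F₀ z‖ / 3, ?_, ?_, ?_⟩
    · have := lt_min (sub_pos.2 hzr) hgap
      positivity
    · linarith [min_le_left (r - ‖rankMap F z‖) ‖rankMap F z - rankMap F₀ z‖]
    · linarith [min_le_right (r - ‖rankMap F z‖) ‖rankMap F z - rankMap F₀ z‖]
  obtain ⟨τ₁, hτ₁, h₁⟩ := Metric.continuous_iff.1 (continuous_rankMap F) z η hη
  obtain ⟨τ₂, hτ₂, h₂⟩ := Metric.continuous_iff.1 (continuous_rankMap F₀) z η hη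
  obtain ⟨τ, hτ, hττ₁, hττ₂⟩ : ∃ τ : ℝ, 0 < τ ∧ τ ≤ τ₁ ∧ 2 * τ ≤ τ₂ :=
    ⟨min τ₁ τ₂ / 2, by positivity, by linarith [min_le_left τ₁ τ₂],
      by linarith [min_le_right τ₁ τ₂]⟩
  -- Membership in the strip bounds each coordinate difference by `2ε = τ / d`, so the `d`
  -- coordinates sum to at most `τ`.
  have hε : 0 < τ / (2 * d) := by positivity
  have hlim := h r hr0 hr1 _ hε
  have hdev := tendsto_measure_exists_le_norm_spatialRank_sub hlaw hindep hη
  have hball : F (Metric.ball z τ)ᶜ < 1 := by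
    refine lt_of_le_of_ne prob_le_one fun h1 => ?_
    rw [prob_compl_eq_one_iff Metric.isOpen_ball.measurableSet] at h1
    exact (Metric.measure_ball_pos volume z hτ).ne' (hF' h1)
  have hup : Tendsto (fun n : ℕ => P {ω | ∃ k : Fin n,
      η ≤ ‖spatialRank (fun j : Fin n => X j ω) (X k ω) - rankMap F (X k ω)‖} +
      F (Metric.ball z τ)ᶜ) atTop (𝓝 (0 + F (Metric.ball z τ)ᶜ)) :=
    hdev.add tendsto_const_nhds
  rw [zero_add] at hup
  refine absurd (le_of_tendsto_of_tendsto hlim hup ?_) (not_le.2 hball)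
  filter_upwards [eventually_gt_atTop 0] with n hn
  have hmeas : P {ω | X 0 ω ∈ (Metric.ball z τ)ᶜ} = F (Metric.ball z τ)ᶜ :=
    (hlaw 0).measure_eq Metric.isOpen_ball.measurableSet.compl
  rw [← hmeas]
  refine (measure_mono fun ω hω => ?_).trans (measure_union_le _ _)
  by_contra hcon
  simp only [Set.mem_union, Set.mem_ofPred_eq, not_or, not_exists, not_le, Set.mem_compl_iff,
    not_not, mem_ball_iff_norm] at hcon
  obtain ⟨hc1, hc2⟩ := hcon
  have hc3 := hc1 ⟨0, hn⟩
  have hω' := forall_qqPlot_subset_iff.1 hω ⟨0, hn⟩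
  simp only at hc3 hω'
  set u := spatialRank (fun j : Fin n => X j ω) (X 0 ω)
  have ha := h₁ (X 0 ω) (by rw [dist_eq_norm]; linarith)
  rw [dist_eq_norm] at ha
  have huz : ‖u - rankMap F z‖ < 2 * η := by
    have := norm_sub_le_norm_sub_add_norm_sub u (rankMap F (X 0 ω)) (rankMap F z)
    linarith
  have hur : ‖u‖ ≤ r := by
    have := norm_le_insert (rankMap F z) u
    rw [norm_sub_rev] at this
    linarith
  have hQ : rankMap F₀ (spatialQuantile F₀ u) = u :=
    rankMap_spatialQuantile F₀ (hur.trans_lt hr1)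
  have hq : ‖X 0 ω - spatialQuantile F₀ u‖ ≤ τ := by
    refine (norm_le_sum_abs _).trans ?_
    refine (Finset.sum_le_sum fun i _ => (abs_sub_lt_of_mem_lineNhd (hω' hur i)).le).trans ?_
    simp only [Finset.sum_const, Finset.card_univ, Fintype.card_fin, nsmul_eq_mul]
    apply le_of_eq
    field_simp
  have hb := h₂ (spatialQuantile F₀ u) (by
    rw [dist_eq_norm]
    have := norm_sub_le_norm_sub_add_norm_sub (spatialQuantile F₀ u) (X 0 ω) z
    rw [norm_sub_rev _ (X 0 ω)] at this
    linarith)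
  rw [dist_eq_norm, hQ] at hb
  have := norm_sub_le_norm_sub_add_norm_sub (rankMap F z) u (rankMap F₀ z)
  rw [norm_sub_rev _ u] at this
  linarith

end Main

end SpatialQQ

theorem theorem2p1 {d : ℕ} (hd : 2 ≤ d)
    (F F₀ : Measure (EuclideanSpace ℝ (Fin d))) [IsProbabilityMeasure F] [IsProbabilityMeasure F₀]
    (hF : SpatialQQ.HasPosLocBddDensity F) (hF₀ : SpatialQQ.HasPosLocBddDensity F₀)
    {Ω : Type*} [MeasurableSpace Ω] (P : Measure Ω) [IsProbabilityMeasure P]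
    (X : ℕ → Ω → EuclideanSpace ℝ (Fin d))
    (hlaw : ∀ j, HasLaw (X j) F P) (hindep : iIndepFun X P) :
    (∀ r : ℝ, 0 < r → r < 1 → ∀ ε : ℝ, 0 < ε →
      Tendsto
        (fun n : ℕ => P {ω | ∀ i : Fin d,
          SpatialQQ.qqPlot (fun k : Fin n => X k ω) F₀ r i ⊆ SpatialQQ.lineNhd ε})
        atTop (𝓝 1)) ↔
    F = F₀ := by
  have : Nonempty (Fin d) := Fin.pos_iff_nonempty.1 (by omega)
  have := hF.nullSingletonClass (by omega)
  have := hF₀.nullSingletonClass (by omega)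
  constructor
  · intro h
    exact SpatialQQ.eq_of_normPotential_eq (SpatialQQ.normPotential_eq_of_rankMap_eq
      (SpatialQQ.rankMap_eq_of_tendsto_measure_qqPlot_subset hd hF.absolutelyContinuous
        hF.absolutelyContinuous_volume hlaw hindep h))
  · rintro rfl r - hr1 ε hε
    exact SpatialQQ.tendsto_measure_qqPlot_subset hd hF.absolutelyContinuous hlaw hindep hr1 hε
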